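/- Let $d\ge 3$, let $\mathcal H=\mathbb C^d$ with computational basis $|0\rangle,\dots,|d-1\rangle$, and let $\mathcal H_A,\mathcal H_B$ be finite-dimensional complex Hilbert spaces. Write $\mathcal D(\mathcal H)$ for the set of density matrices on $\mathcal H$, $\mathcal D^{\mathrm R}(\mathcal H)$ for those with real entries in the computational basis, and $\mathcal P^{\mathrm R}(\mathcal H)$ for the pure (rank-one) states in $\mathcal D^{\mathrm R}(\mathcal H)$. Let $M:\mathcal H\to\mathcal H_A\otimes\mathcal H_B$ be an isometry, put $M(\rho)=M\rho M^\dagger$, and suppose that $M$ masks $\mathcal D^{\mathrm R}(\mathcal H)$, i.e. there are fixed density matrices $\tau_A,\tau_B$ with $\operatorname{tr}_B M(\rho)=\tau_A$ and $\operatorname{tr}_A M(\rho)=\tau_B$ for all $\rho\in\mathcal D^{\mathrm R}(\mathcal H)$. Let $|\Psi_0\rangle=M|0\rangle$. Then: 1. For every $\rho\in\mathcal D(\mathcal H)$ the state $M(\rho)$ can be created from $|\Psi_0\rangle\langle\Psi_0|$ by (finitely many rounds of) local operations and classical communication (LOCC). 2. $E(M(\rho))\le E(|\Psi_0\rangle\langle\Psi_0|)$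 for every $\rho\in\mathcal D(\mathcal H)$ and every entanglement monotone $E$, i.e. every real-valued function $E$ of the states on $\mathcal H_A\otimes\mathcal H_B$ that does not increase under LOCC. 3. If moreover $E$ is convex and strict, where strict means that $E(|\Psi_1\rangle\langle\Psi_1|)>E(|\Psi_2\rangle\langle\Psi_2|)$ for all pure states such that $|\Psi_1\rangle$ can be turned into $|\Psi_2\rangle$ by LOCC but not vice versa, then for every $\rho\in\mathcal D(\mathcal H)$ one has $E(M(\rho))=E(|\Psi_0\rangle\langle\Psi_0|)$ if and only if $\rho\in\mathcal P^{\mathrm R}(\mathcal H)$. -/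

import Mathlib

open scoped Kronecker Matrix ComplexOrder

noncomputable section

namespace Masking

/-- Density matrices indexed by `ι`: positive semidefinite with unit trace. -/
def states (ι : Type) [Fintype ι] : Set (Matrix ι ι ℂ) :=
  {ρ | ρ.PosSemidef ∧ ρ.trace = 1}

/-- The operator `|ψ⟩⟨ψ|`. -/
def proj {ι : Type} (ψ : ι → ℂ) : Matrix ι ι ℂ :=
  Matrix.vecMulVec ψ (star ψ)

/-- Pure states: density matrices of the form `|ψ⟩⟨ψ|`
(unit trace forces `ψ` to be a unit vector). -/
def pureStates (ι : Type) [Fintype ι] : Set (Matrix ι ι ℂ) :=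
  {ρ | ρ ∈ states ι ∧ ∃ ψ : ι → ℂ, ρ = proj ψ}

/-- Density matrices whose entries in the computational basis are all real. -/
def realStates (ι : Type) [Fintype ι] : Set (Matrix ι ι ℂ) :=
  {ρ | ρ ∈ states ι ∧ ∀ i j, (ρ i j).im = 0}

/-- Real pure states. -/
def realPureStates (ι : Type) [Fintype ι] : Set (Matrix ι ι ℂ) :=
  pureStates ι ∩ realStates ι

/-- Partial trace over the second subsystem. -/
def traceB {a b : ℕ} (X : Matrix (Fin a × Fin b) (Fin a × Fin b) ℂ) :
    Matrix (Fin a) (Fin a) ℂ :=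
  Matrix.of fun i j => ∑ k, X (i, k) (j, k)

/-- Partial trace over the first subsystem. -/
def traceA {a b : ℕ} (X : Matrix (Fin a × Fin b) (Fin a × Fin b) ℂ) :
    Matrix (Fin b) (Fin b) ℂ :=
  Matrix.of fun i j => ∑ k, X (k, i) (k, j)

/-- `M` is an isometry `ℂ^d → ℂ^a ⊗ ℂ^b` such that both reduced states of `M ρ M†` are the same
for all `ρ ∈ S`. -/
def IsMasker {d a b : ℕ} (M : Matrix (Fin a × Fin b) (Fin d) ℂ)
    (S : Set (Matrix (Fin d) (Fin d) ℂ)) : Prop :=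
  Mᴴ * M = 1 ∧
    ∃ τA ∈ states (Fin a), ∃ τB ∈ states (Fin b),
      ∀ ρ ∈ S, traceB (M * ρ * Mᴴ) = τA ∧ traceA (M * ρ * Mᴴ) = τB

/-- A finite-round protocol of local operations and classical communication that starts on
`ℂ^a ⊗ ℂ^b` and ends on `ℂ^a' ⊗ ℂ^b'`. At each step one party performs a local quantum measurement
given by Kraus operators `K i` with `∑ i, (K i)† (K i) = 1`, whose output dimension may be arbitrary
and may depend on the outcome, and announces the outcome `i`; the rest of the protocol may
depend on `i`. A general local channel is a step whose outcome is afterwards ignored. -/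
inductive LOCCProtocol (a' b' : ℕ) : ℕ → ℕ → Type
  | done : LOCCProtocol a' b' a' b'
  | alice {a b k : ℕ} (c : Fin k → ℕ) (K : ∀ i, Matrix (Fin (c i)) (Fin a) ℂ)
      (hK : ∑ i, (K i)ᴴ * K i = 1)
      (next : ∀ i, LOCCProtocol a' b' (c i) b) : LOCCProtocol a' b' a b
  | bob {a b k : ℕ} (c : Fin k → ℕ) (K : ∀ i, Matrix (Fin (c i)) (Fin b) ℂ)
      (hK : ∑ i, (K i)ᴴ * K i = 1)
      (next : ∀ i, LOCCProtocol a' b' a (c i)) : LOCCProtocol a' b' a b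

/-- The quantum channel implemented by a protocol (all outcomes are forgotten at the end). -/
def LOCCProtocol.channel {a' b' : ℕ} : {a b : ℕ} → LOCCProtocol a' b' a b →
    Matrix (Fin a × Fin b) (Fin a × Fin b) ℂ → Matrix (Fin a' × Fin b') (Fin a' × Fin b') ℂ
  | _, _, .done, X => X
  | _, b, .alice _ K _ next, X =>
      ∑ i, (next i).channel
        ((K i ⊗ₖ (1 : Matrix (Fin b) (Fin b) ℂ)) * X * (K i ⊗ₖ (1 : Matrix (Fin b) (Fin b) ℂ))ᴴ)
  | a, _, .bob _ K _ next, X =>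
      ∑ i, (next i).channel
        (((1 : Matrix (Fin a) (Fin a) ℂ) ⊗ₖ K i) * X * ((1 : Matrix (Fin a) (Fin a) ℂ) ⊗ₖ K i)ᴴ)

/-- `σ` can be created from `ρ` by LOCC. -/
def LOCCConvertible {a b a' b' : ℕ} (ρ : Matrix (Fin a × Fin b) (Fin a × Fin b) ℂ)
    (σ : Matrix (Fin a' × Fin b') (Fin a' × Fin b') ℂ) : Prop :=
  ∃ P : LOCCProtocol a' b' a b, P.channel ρ = σ

/-- An entanglement monotone on `ℂ^a ⊗ ℂ^b`: a real function of the bipartite states (values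
outside the set of states are irrelevant) that does not increase under LOCC. -/
def IsEntanglementMonotone {a b : ℕ}
    (E : Matrix (Fin a × Fin b) (Fin a × Fin b) ℂ → ℝ) : Prop :=
  ∀ ρ ∈ states (Fin a × Fin b), ∀ σ ∈ states (Fin a × Fin b),
    LOCCConvertible ρ σ → E σ ≤ E ρ

/-- A strict entanglement monotone: a monotone with `E(Ψ₁) > E(Ψ₂)` for pure states whenever `Ψ₁`
can be turned into `Ψ₂` by LOCC but not vice versa. -/
def IsStrictEntanglementMonotone {a b : ℕ}
    (E : Matrix (Fin a × Fin b) (Fin a × Fin b) ℂ → ℝ) : Prop :=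
  IsEntanglementMonotone E ∧
    ∀ ρ ∈ pureStates (Fin a × Fin b), ∀ σ ∈ pureStates (Fin a × Fin b),
      LOCCConvertible ρ σ → ¬ LOCCConvertible σ ρ → E σ < E ρ

end Masking

end

/-!
The coefficient matrices `A x` of the masked real vectors form a real-linear family with
`A x * (A x)ᴴ = ‖x‖ ^ 2 • σ` and `(A x)ᴴ * A x = ‖x‖ ^ 2 • τ`; polarization turns these into
Clifford-type relations. Up to a phase, every unit vector of `ℂ ^ d` is `x + iy` with `x ⟂ y` real.
As `d ≥ 3`, there is a real unit vector orthogonal to both, and it yields a local operation that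
conjugates `A x + i A y` into `A x - i A y`. The Gram matrices of these two matrices add up to `2τ`,
so measuring one party and then correcting the second outcome by that operation prepares the image
of `x + iy` from that of any real state.

Conversely, the squared operator norm of the coefficient matrix does not decrease on average under
LOCC, and for `A x + i A y` it exceeds `‖τ‖` unless `x = 0` or `y = 0`. Hence the conversion is
irreversible for nonreal pure states. If a convex strict monotone is maximal at `ρ`, it is maximal
at every pure state `σ` with `p • σ ≤ ρ` for some `p > 0`; all of these are then real, which forces
`ρ` to be real and pure.
-/

noncomputable section

namespace Masking

open scoped MatrixOrder Matrix.Norms.L2Operator RealInnerProductSpace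

section MoorePenrose

variable {n : Type*} [Fintype n] [DecidableEq n]

/-- The Moore–Penrose inverse of a Hermitian matrix, inverting its nonzero eigenvalues. On the
kernel it vanishes because `0⁻¹ = 0`. -/
def pinv (τ : Matrix n n ℂ) : Matrix n n ℂ :=
  cfc (fun t : ℝ => t⁻¹) τ

theorem isHermitian_pinv (τ : Matrix n n ℂ) : (pinv τ).IsHermitian :=
  cfc_predicate _ τ

theorem commute_pinv {τ Z : Matrix n n ℂ} (hτ : τ.IsHermitian) (h : Commute τ Z) :
    Commute (pinv τ) Z :=
  IsSelfAdjoint.commute_cfc hτ h _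

theorem mul_pinv_mul_self {τ : Matrix n n ℂ} (hτ : τ.IsHermitian) : τ * pinv τ * τ = τ := by
  have hcont : ∀ f : ℝ → ℝ, ContinuousOn f (spectrum ℝ τ) :=
    fun f => Matrix.finite_real_spectrum.continuousOn f
  have hid : cfc (fun t : ℝ => t) τ = τ := cfc_id' ℝ τ hτ.isSelfAdjoint
  calc
    τ * pinv τ * τ = cfc (fun t : ℝ => t * t⁻¹ * t) τ := by
      rw [cfc_mul _ _ τ (hcont _) (hcont _), cfc_mul _ _ τ (hcont _) (hcont _), hid, pinv]
    _ = τ := by simp only [mul_inv_mul_cancel, hid]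

theorem pinv_mul_self_mul_pinv {τ : Matrix n n ℂ} (hτ : τ.IsHermitian) :
    pinv τ * τ * pinv τ = pinv τ := by
  have hcont : ∀ f : ℝ → ℝ, ContinuousOn f (spectrum ℝ τ) :=
    fun f => Matrix.finite_real_spectrum.continuousOn f
  have hid : cfc (fun t : ℝ => t) τ = τ := cfc_id' ℝ τ hτ.isSelfAdjoint
  calc
    pinv τ * τ * pinv τ = cfc (fun t : ℝ => t⁻¹ * t * t⁻¹) τ := by
      rw [cfc_mul _ _ τ (hcont _) (hcont _), cfc_mul _ _ τ (hcont _) (hcont _), hid, pinv]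
    _ = pinv τ := by
      have hinv : ∀ t : ℝ, t⁻¹ * t * t⁻¹ = t⁻¹ :=
        fun t => by simpa only [inv_inv] using mul_inv_mul_cancel t⁻¹
      simp only [hinv, pinv]

theorem isStarProjection_pinv_mul_self {τ : Matrix n n ℂ} (hτ : τ.IsHermitian) :
    IsStarProjection (pinv τ * τ) where
  isIdempotentElem := by
    rw [IsIdempotentElem, ← Matrix.mul_assoc, pinv_mul_self_mul_pinv hτ]
  isSelfAdjoint := (IsSelfAdjoint.commute_iff (isHermitian_pinv τ) hτ).1
    (commute_pinv hτ (Commute.refl τ))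

end MoorePenrose

theorem norm_le_one_of_isStarProjection_conjTranspose_mul_self {m n : Type*} [Fintype m]
    [Fintype n] [DecidableEq n] {K : Matrix m n ℂ} (hK : IsStarProjection (Kᴴ * K)) : ‖K‖ ≤ 1 := by
  rw [← abs_norm, ← sq_le_one_iff_abs_le_one, sq, ← Matrix.l2_opNorm_conjTranspose_mul_self]
  exact hK.norm_le

theorem exists_norm_eq_one_inner_eq_zero {E : Type*} [NormedAddCommGroup E]
    [InnerProductSpace ℝ E] (hE : 3 ≤ Module.finrank ℝ E) (x y : E) :
    ∃ w : E, ‖w‖ = 1 ∧ ⟪x, w⟫ = 0 ∧ ⟪y, w⟫ = 0 := by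
  classical
  have : FiniteDimensional ℝ E := FiniteDimensional.of_finrank_pos (by omega)
  let s : Submodule ℝ E := Submodule.span ℝ ({x, y} : Finset E)
  have hs : Module.finrank ℝ s ≤ 2 :=
    (finrank_span_finset_le_card (R := ℝ) {x, y}).trans Finset.card_le_two
  have hne : sᗮ ≠ ⊥ := by
    intro hbot
    have hsum := s.finrank_add_finrank_orthogonal
    rw [hbot, finrank_bot] at hsum
    omega
  obtain ⟨w, hw, hw0⟩ := Submodule.exists_mem_ne_zero_of_ne_bot hne
  have horth : ∀ z ∈ s, ⟪z, ‖w‖⁻¹ • w⟫ = 0 := fun z hz => by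
    rw [real_inner_smul_right, (Submodule.mem_orthogonal s w).1 hw z hz, mul_zero]
  exact ⟨‖w‖⁻¹ • w, norm_smul_inv_norm hw0, horth x (Submodule.subset_span (by simp)),
    horth y (Submodule.subset_span (by simp))⟩

theorem conjTranspose_mul_mul_le_conjTranspose_mul_mul {m n : Type*} [Fintype m]
    [Finite n] {P Q : Matrix m m ℂ} (hPQ : P ≤ Q) (X : Matrix m n ℂ) : Xᴴ * P * X ≤ Xᴴ * Q * X := by
  rw [Matrix.le_iff] at hPQ ⊢
  simpa only [Matrix.mul_sub, Matrix.sub_mul] using hPQ.conjTranspose_mul_mul_same X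

theorem conjTranspose_mul_self_le_one {m n : Type*} [Fintype m] [Fintype n] [DecidableEq n]
    {X : Matrix m n ℂ} (hX : ‖X‖ ≤ 1) : Xᴴ * X ≤ 1 := by
  have hnonneg : 0 ≤ Xᴴ * X := (Matrix.posSemidef_conjTranspose_mul_self X).nonneg
  rw [← CStarAlgebra.norm_le_one_iff_of_nonneg _ hnonneg, Matrix.l2_opNorm_conjTranspose_mul_self]
  exact mul_le_one₀ hX (norm_nonneg X) hX

section ConstantMarginals

variable {m n E : Type*} [Fintype m] [Fintype n] [NormedAddCommGroup E] [InnerProductSpace ℝ E]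

/-- A real-linear family of coefficient matrices of bipartite vectors whose two reduced operators
`σ` and `τ` do not depend on the unit vector `x`. -/
structure HasConstantMarginals (A : E →ₗ[ℝ] Matrix m n ℂ) (σ : Matrix m m ℂ)
    (τ : Matrix n n ℂ) : Prop where
  mul_conjTranspose : ∀ x, A x * (A x)ᴴ = (‖x‖ ^ 2) • σ
  conjTranspose_mul : ∀ x, (A x)ᴴ * A x = (‖x‖ ^ 2) • τ

/-- The left factor of a local operation which, for a family with marginal `τ` and orthonormal `u`
and `w`, maps `A x` to `A (R x)`, where `R` is the reflection fixing `u` and `w` and negating the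
vectors orthogonal to both. -/
def leftReflector [DecidableEq n] (A : E →ₗ[ℝ] Matrix m n ℂ) (τ : Matrix n n ℂ) (u w : E) :
    Matrix m m ℂ :=
  A w * pinv τ * (A u)ᴴ

/-- The right factor of the local operation of which `leftReflector` is the left factor. -/
def rightReflector [DecidableEq n] (A : E →ₗ[ℝ] Matrix m n ℂ) (τ : Matrix n n ℂ) (u w : E) :
    Matrix n n ℂ :=
  (A w)ᴴ * A u * pinv τ

namespace HasConstantMarginals

variable {A : E →ₗ[ℝ] Matrix m n ℂ} {σ : Matrix m m ℂ} {τ : Matrix n n ℂ} {u w x y : E}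

theorem mul_conjTranspose_of_norm_eq_one (h : HasConstantMarginals A σ τ) (hu : ‖u‖ = 1) :
    A u * (A u)ᴴ = σ := by
  rw [h.mul_conjTranspose, hu, one_pow, one_smul]

theorem conjTranspose_mul_of_norm_eq_one (h : HasConstantMarginals A σ τ) (hu : ‖u‖ = 1) :
    (A u)ᴴ * A u = τ := by
  rw [h.conjTranspose_mul, hu, one_pow, one_smul]

theorem isHermitian_right (h : HasConstantMarginals A σ τ) (hu : ‖u‖ = 1) : τ.IsHermitian :=
  h.conjTranspose_mul_of_norm_eq_one hu ▸ Matrix.isHermitian_conjTranspose_mul_self _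

theorem conjTranspose (h : HasConstantMarginals A σ τ) :
    HasConstantMarginals ((Matrix.conjTransposeLinearEquiv m n ℝ ℂ).toLinearMap ∘ₗ A) τ σ where
  mul_conjTranspose x := by simpa using h.conjTranspose_mul x
  conjTranspose_mul x := by simpa using h.mul_conjTranspose x

theorem mul_conjTranspose_of_inner_eq_zero (h : HasConstantMarginals A σ τ)
    (hxy : ⟪x, y⟫ = 0) : A x * (A y)ᴴ = -(A y * (A x)ᴴ) := by
  have hsum : (‖x‖ ^ 2 • σ + ‖y‖ ^ 2 • σ) + (A x * (A y)ᴴ + A y * (A x)ᴴ) =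
      ‖x‖ ^ 2 • σ + ‖y‖ ^ 2 • σ := by
    calc
      _ = A (x + y) * (A (x + y))ᴴ := by
        rw [map_add, Matrix.conjTranspose_add, Matrix.add_mul, Matrix.mul_add, Matrix.mul_add,
          h.mul_conjTranspose, h.mul_conjTranspose]
        abel
      _ = ‖x‖ ^ 2 • σ + ‖y‖ ^ 2 • σ := by
        rw [h.mul_conjTranspose, norm_add_sq_real, hxy, mul_zero, add_zero, add_smul]
  exact eq_neg_of_add_eq_zero_left (add_eq_left.1 hsum)

theorem conjTranspose_mul_of_inner_eq_zero (h : HasConstantMarginals A σ τ)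
    (hxy : ⟪x, y⟫ = 0) : (A x)ᴴ * A y = -((A y)ᴴ * A x) := by
  simpa using h.conjTranspose.mul_conjTranspose_of_inner_eq_zero hxy

theorem mul_right (h : HasConstantMarginals A σ τ) (x : E) : A x * τ = σ * A x := by
  rcases eq_or_ne x 0 with rfl | hx
  · simp only [map_zero, Matrix.mul_zero, Matrix.zero_mul]
  · refine smul_right_injective _ (pow_ne_zero 2 (norm_ne_zero_iff.2 hx)) ?_
    dsimp only
    rw [← Matrix.mul_smul, ← Matrix.smul_mul, ← h.mul_conjTranspose, ← h.conjTranspose_mul,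
      Matrix.mul_assoc]

theorem conjTranspose_mul_left (h : HasConstantMarginals A σ τ) (x : E) :
    (A x)ᴴ * σ = τ * (A x)ᴴ := by
  simpa using h.conjTranspose.mul_right x

theorem conjTranspose_mul_add_I_smul (h : HasConstantMarginals A σ τ) (hxy : ⟪x, y⟫ = 0)
    (hnorm : ‖x‖ ^ 2 + ‖y‖ ^ 2 = 1) :
    (A x + Complex.I • A y)ᴴ * (A x + Complex.I • A y) =
      τ + (2 * Complex.I) • ((A x)ᴴ * A y) := by
  have hyx : (A y)ᴴ * A x = -((A x)ᴴ * A y) :=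
    h.conjTranspose_mul_of_inner_eq_zero ((real_inner_comm x y).trans hxy)
  calc
    _ = (A x)ᴴ * A x + (A y)ᴴ * A y +
        (Complex.I • ((A x)ᴴ * A y) - Complex.I • ((A y)ᴴ * A x)) := by
      simp only [Matrix.conjTranspose_add, Matrix.conjTranspose_smul, Matrix.add_mul,
        Matrix.mul_add, Matrix.smul_mul, Matrix.mul_smul, Complex.star_def, Complex.conj_I,
        neg_smul, Matrix.neg_mul, smul_add, smul_neg, smul_smul, Complex.I_mul_I, one_smul]
      abel
    _ = τ + (2 * Complex.I) • ((A x)ᴴ * A y) := by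
      rw [h.conjTranspose_mul, h.conjTranspose_mul, ← add_smul, hnorm, one_smul, hyx, smul_neg,
        sub_neg_eq_add, ← two_smul ℂ, smul_smul]

theorem conjTranspose_mul_sub_I_smul (h : HasConstantMarginals A σ τ) (hxy : ⟪x, y⟫ = 0)
    (hnorm : ‖x‖ ^ 2 + ‖y‖ ^ 2 = 1) :
    (A x - Complex.I • A y)ᴴ * (A x - Complex.I • A y) =
      τ - (2 * Complex.I) • ((A x)ᴴ * A y) := by
  simpa [sub_eq_add_neg] using
    h.conjTranspose_mul_add_I_smul (x := x) (y := -y) (by simpa using hxy) (by simpa using hnorm)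

theorem two_I_smul_conjTranspose_mul_mul_self (h : HasConstantMarginals A σ τ)
    (hxy : ⟪x, y⟫ = 0) :
    ((2 * Complex.I) • ((A x)ᴴ * A y)) * ((2 * Complex.I) • ((A x)ᴴ * A y)) =
      (4 * ‖x‖ ^ 2 * ‖y‖ ^ 2) • (τ * τ) := by
  have hI : 2 * Complex.I * (2 * Complex.I) = -4 := by linear_combination 4 * Complex.I_mul_I
  calc
    _ = (4 : ℂ) • ((A x)ᴴ * (A y * (A y)ᴴ) * A x) := by
      nth_rewrite 2 [h.conjTranspose_mul_of_inner_eq_zero hxy]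
      rw [Matrix.smul_mul, Matrix.mul_smul, smul_smul, hI, Matrix.mul_neg, smul_neg, neg_smul,
        neg_neg]
      simp only [Matrix.mul_assoc]
    _ = (4 : ℂ) • ‖x‖ ^ 2 • ‖y‖ ^ 2 • (τ * τ) := by
      rw [h.mul_conjTranspose, Matrix.mul_smul, h.conjTranspose_mul_left, Matrix.smul_mul,
        Matrix.mul_assoc, h.conjTranspose_mul, Matrix.mul_smul, smul_comm (‖x‖ ^ 2)]
    _ = (4 * ‖x‖ ^ 2 * ‖y‖ ^ 2) • (τ * τ) := by
      rw [← Complex.ofReal_ofNat, Complex.coe_smul, smul_smul, smul_smul, mul_assoc]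

variable [DecidableEq n]

theorem mul_pinv_mul (h : HasConstantMarginals A σ τ) (hτ : τ.IsHermitian) (x : E) :
    A x * (pinv τ * τ) = A x := by
  have hker : A x * (1 - pinv τ * τ) = 0 := by
    rw [← Matrix.conjTranspose_mul_self_mul_eq_zero, h.conjTranspose_mul, Matrix.smul_mul,
      Matrix.mul_sub, Matrix.mul_one, ← Matrix.mul_assoc, mul_pinv_mul_self hτ, sub_self, smul_zero]
  rw [Matrix.mul_sub, Matrix.mul_one, sub_eq_zero] at hker
  exact hker.symm

theorem mul_pinv_mul_conjTranspose_mul (h : HasConstantMarginals A σ τ) (hu : ‖u‖ = 1) (x : E) :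
    A u * pinv τ * (A u)ᴴ * A x = A x := by
  have hτ := h.isHermitian_right hu
  have hrange : A u * pinv τ * (A u)ᴴ * σ = σ := by
    rw [Matrix.mul_assoc (A u * pinv τ), h.conjTranspose_mul_left, Matrix.mul_assoc (A u),
      ← Matrix.mul_assoc (pinv τ), ← Matrix.mul_assoc (A u), h.mul_pinv_mul hτ,
      h.mul_conjTranspose_of_norm_eq_one hu]
  classical
  have hcoker : (1 - A u * pinv τ * (A u)ᴴ) * A x = 0 := by
    rw [← Matrix.mul_self_mul_conjTranspose_eq_zero, h.mul_conjTranspose, Matrix.mul_smul,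
      Matrix.sub_mul, Matrix.one_mul, hrange, sub_self, smul_zero]
  rw [Matrix.sub_mul, Matrix.one_mul, sub_eq_zero] at hcoker
  exact hcoker.symm

theorem isStarProjection_mul_pinv_mul_conjTranspose
    (h : HasConstantMarginals A σ τ) (hu : ‖u‖ = 1) :
    IsStarProjection (A u * pinv τ * (A u)ᴴ) where
  isIdempotentElem := by
    classical
    rw [IsIdempotentElem, ← Matrix.mul_assoc, ← Matrix.mul_assoc,
      h.mul_pinv_mul_conjTranspose_mul hu]
  isSelfAdjoint := Matrix.isHermitian_mul_mul_conjTranspose _ (isHermitian_pinv τ)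

theorem norm_leftReflector_le_one [DecidableEq m] (h : HasConstantMarginals A σ τ)
    (hu : ‖u‖ = 1) (hw : ‖w‖ = 1) : ‖leftReflector A τ u w‖ ≤ 1 := by
  refine norm_le_one_of_isStarProjection_conjTranspose_mul_self ?_
  have hgram : (leftReflector A τ u w)ᴴ * leftReflector A τ u w = A u * pinv τ * (A u)ᴴ := by
    simp only [leftReflector, Matrix.conjTranspose_mul, Matrix.conjTranspose_conjTranspose,
      (isHermitian_pinv τ).eq]
    calc
      A u * (pinv τ * (A w)ᴴ) * (A w * pinv τ * (A u)ᴴ) =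
          A u * (pinv τ * ((A w)ᴴ * A w) * pinv τ) * (A u)ᴴ := by simp only [Matrix.mul_assoc]
      _ = A u * pinv τ * (A u)ᴴ := by
        rw [h.conjTranspose_mul_of_norm_eq_one hw, pinv_mul_self_mul_pinv (h.isHermitian_right hu)]
  rw [hgram]
  exact h.isStarProjection_mul_pinv_mul_conjTranspose hu

theorem norm_rightReflector_le_one (h : HasConstantMarginals A σ τ)
    (hu : ‖u‖ = 1) (hw : ‖w‖ = 1) : ‖rightReflector A τ u w‖ ≤ 1 := by
  have hτ := h.isHermitian_right hu
  refine norm_le_one_of_isStarProjection_conjTranspose_mul_self ?_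
  have hgram : (rightReflector A τ u w)ᴴ * rightReflector A τ u w = pinv τ * τ := by
    simp only [rightReflector, Matrix.conjTranspose_mul, Matrix.conjTranspose_conjTranspose,
      (isHermitian_pinv τ).eq]
    calc
      pinv τ * ((A u)ᴴ * A w) * ((A w)ᴴ * A u * pinv τ) =
          pinv τ * ((A u)ᴴ * (A w * (A w)ᴴ)) * A u * pinv τ := by simp only [Matrix.mul_assoc]
      _ = pinv τ * τ * ((A u)ᴴ * A u) * pinv τ := by
        rw [h.mul_conjTranspose_of_norm_eq_one hw, h.conjTranspose_mul_left]
        simp only [Matrix.mul_assoc]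
      _ = pinv τ * τ := by
        rw [h.conjTranspose_mul_of_norm_eq_one hu, Matrix.mul_assoc,
          ← (commute_pinv hτ (Commute.refl τ)).eq, ← Matrix.mul_assoc, pinv_mul_self_mul_pinv hτ]
  rw [hgram]
  exact isStarProjection_pinv_mul_self hτ

theorem leftReflector_mul_self_mul_rightReflector (h : HasConstantMarginals A σ τ)
    (hu : ‖u‖ = 1) (hw : ‖w‖ = 1) :
    leftReflector A τ u w * A u * rightReflector A τ u w = A u := by
  have hτ := h.isHermitian_right hu
  calc
    leftReflector A τ u w * A u * rightReflector A τ u w =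
        A w * (pinv τ * ((A u)ᴴ * A u)) * (A w)ᴴ * (A u * pinv τ) := by
      simp only [leftReflector, rightReflector, Matrix.mul_assoc]
    _ = σ * A u * pinv τ := by
      rw [h.conjTranspose_mul_of_norm_eq_one hu, h.mul_pinv_mul hτ,
        h.mul_conjTranspose_of_norm_eq_one hw, Matrix.mul_assoc]
    _ = A u * (pinv τ * τ) := by
      rw [← h.mul_right, (commute_pinv hτ (Commute.refl τ)).eq, Matrix.mul_assoc]
    _ = A u := h.mul_pinv_mul hτ u

theorem leftReflector_mul_mul_rightReflector (h : HasConstantMarginals A σ τ)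
    (hu : ‖u‖ = 1) (hw : ‖w‖ = 1) (huw : ⟪u, w⟫ = 0) (huy : ⟪u, y⟫ = 0) (hwy : ⟪w, y⟫ = 0) :
    leftReflector A τ u w * A y * rightReflector A τ u w = -A y := by
  have hτ := h.isHermitian_right hu
  have hmiddle : (A u)ᴴ * A y * ((A w)ᴴ * A u) = -((A w)ᴴ * A y * τ) := by
    calc
      (A u)ᴴ * A y * ((A w)ᴴ * A u) = (A u)ᴴ * (A y * (A w)ᴴ) * A u := by
        simp only [Matrix.mul_assoc]
      _ = -((A u)ᴴ * A w * ((A y)ᴴ * A u)) := by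
        rw [h.mul_conjTranspose_of_inner_eq_zero ((real_inner_comm w y).trans hwy)]
        simp only [Matrix.mul_neg, Matrix.neg_mul, Matrix.mul_assoc]
      _ = -((A w)ᴴ * (A u * (A u)ᴴ) * A y) := by
        rw [h.conjTranspose_mul_of_inner_eq_zero huw, h.conjTranspose_mul_of_inner_eq_zero
          ((real_inner_comm u y).trans huy)]
        simp only [Matrix.mul_neg, Matrix.neg_mul, neg_neg, Matrix.mul_assoc]
      _ = -((A w)ᴴ * A y * τ) := by
        rw [h.mul_conjTranspose_of_norm_eq_one hu, Matrix.mul_assoc, ← h.mul_right,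
          Matrix.mul_assoc]
  calc
    leftReflector A τ u w * A y * rightReflector A τ u w =
        A w * pinv τ * ((A u)ᴴ * A y * ((A w)ᴴ * A u)) * pinv τ := by
      simp only [leftReflector, rightReflector, Matrix.mul_assoc]
    _ = -(A w * pinv τ * (A w)ᴴ * A y * (τ * pinv τ)) := by
      rw [hmiddle]
      simp only [Matrix.mul_neg, Matrix.neg_mul, Matrix.mul_assoc]
    _ = -A y := by
      rw [h.mul_pinv_mul_conjTranspose_mul hw, ← (commute_pinv hτ (Commute.refl τ)).eq,
        h.mul_pinv_mul hτ]

theorem exists_conj [DecidableEq m] (h : HasConstantMarginals A σ τ)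
    (hE : 3 ≤ Module.finrank ℝ E) (hxy : ⟪x, y⟫ = 0) :
    ∃ (X : Matrix m m ℂ) (Y : Matrix n n ℂ), ‖X‖ ≤ 1 ∧ ‖Y‖ ≤ 1 ∧
      ∀ c : ℂ, X * (A x + c • A y) * Y = A x - c • A y := by
  rcases eq_or_ne x 0 with rfl | hx
  · refine ⟨1, -1, (IsStarProjection.one _).norm_le, ?_, fun c => by simp⟩
    simpa only [norm_neg] using (IsStarProjection.one _).norm_le
  · obtain ⟨w, hw, hxw, hyw⟩ := exists_norm_eq_one_inner_eq_zero hE x y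
    set u : E := ‖x‖⁻¹ • x with hu_def
    have hu : ‖u‖ = 1 := norm_smul_inv_norm hx
    have hxu : x = ‖x‖ • u := by rw [hu_def, smul_inv_smul₀ (norm_ne_zero_iff.2 hx)]
    have huw : ⟪u, w⟫ = 0 := by rw [real_inner_smul_left, hxw, mul_zero]
    have huy : ⟪u, y⟫ = 0 := by rw [real_inner_smul_left, hxy, mul_zero]
    refine ⟨leftReflector A τ u w, rightReflector A τ u w, h.norm_leftReflector_le_one hu hw,
      h.norm_rightReflector_le_one hu hw, fun c => ?_⟩
    rw [hxu, map_smul, Matrix.mul_add, Matrix.add_mul, Matrix.mul_smul, Matrix.smul_mul,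
      Matrix.mul_smul, Matrix.smul_mul, h.leftReflector_mul_self_mul_rightReflector hu hw,
      h.leftReflector_mul_mul_rightReflector hu hw huw huy ((real_inner_comm y w).trans hyw),
      smul_neg, sub_eq_add_neg]

theorem conjTranspose_mul_self_add_le_one (h : HasConstantMarginals A σ τ) (hu : ‖u‖ = 1)
    {l : Type*} [Fintype l] [DecidableEq l] [DecidableEq m] {B C : Matrix l n ℂ} {X : Matrix l l ℂ}
    (hX : ‖X‖ ≤ 1) (hBC : Bᴴ * B + Cᴴ * C = τ) :
    (B * (pinv τ * (A u)ᴴ))ᴴ * (B * (pinv τ * (A u)ᴴ)) +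
      (X * (C * (pinv τ * (A u)ᴴ)))ᴴ * (X * (C * (pinv τ * (A u)ᴴ))) ≤ 1 := by
  set N := pinv τ * (A u)ᴴ with hN
  calc
    (B * N)ᴴ * (B * N) + (X * (C * N))ᴴ * (X * (C * N)) =
        (B * N)ᴴ * (B * N) + (C * N)ᴴ * (Xᴴ * X) * (C * N) := by
      simp only [Matrix.conjTranspose_mul, Matrix.mul_assoc]
    _ ≤ (B * N)ᴴ * (B * N) + (C * N)ᴴ * (1 : Matrix l l ℂ) * (C * N) := by
      gcongr
      exact conjTranspose_mul_mul_le_conjTranspose_mul_mul (conjTranspose_mul_self_le_one hX) _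
    _ = Nᴴ * (Bᴴ * B + Cᴴ * C) * N := by
      simp only [Matrix.conjTranspose_mul, Matrix.mul_add, Matrix.add_mul, Matrix.mul_assoc,
        Matrix.one_mul]
    _ = A u * (pinv τ * τ * pinv τ) * (A u)ᴴ := by
      simp only [hBC, hN, Matrix.conjTranspose_mul, Matrix.conjTranspose_conjTranspose,
        (isHermitian_pinv τ).eq, Matrix.mul_assoc]
    _ = A u * pinv τ * (A u)ᴴ := by rw [pinv_mul_self_mul_pinv (h.isHermitian_right hu)]
    _ ≤ 1 := (h.isStarProjection_mul_pinv_mul_conjTranspose hu).le_one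

theorem mul_pinv_mul_conjTranspose_mul_self (h : HasConstantMarginals A σ τ) (hu : ‖u‖ = 1)
    (x y : E) (c : ℂ) : (A x + c • A y) * (pinv τ * (A u)ᴴ) * A u = A x + c • A y := by
  have hτ := h.isHermitian_right hu
  rw [Matrix.mul_assoc, Matrix.mul_assoc, h.conjTranspose_mul_of_norm_eq_one hu,
    Matrix.add_mul, Matrix.smul_mul, h.mul_pinv_mul hτ, h.mul_pinv_mul hτ]

theorem exists_measurement [DecidableEq m] (h : HasConstantMarginals A σ τ)
    (hE : 3 ≤ Module.finrank ℝ E) (hu : ‖u‖ = 1) (hxy : ⟪x, y⟫ = 0)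
    (hnorm : ‖x‖ ^ 2 + ‖y‖ ^ 2 = 1) :
    ∃ (K : Fin 2 → Matrix m m ℂ) (Y : Fin 2 → Matrix n n ℂ), ∑ i, (K i)ᴴ * K i ≤ 1 ∧
      (∀ i, ‖Y i‖ ≤ 1) ∧ ∀ i, K i * A u * Y i = ((√2)⁻¹ : ℝ) • (A x + Complex.I • A y) := by
  obtain ⟨X, Y, hX, hY, hconj⟩ := h.exists_conj hE (y := -y) (by simpa using hxy)
  set B := A x + Complex.I • A y with hB
  set C := A x - Complex.I • A y with hC
  set N := pinv τ * (A u)ᴴ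
  have hXY : X * C * Y = B := by simpa [hB, hC, sub_eq_add_neg] using hconj Complex.I
  have hBN : B * N * A u = B := h.mul_pinv_mul_conjTranspose_mul_self hu x y _
  have hCN : C * N * A u = C := by
    simpa [hC, sub_eq_add_neg] using h.mul_pinv_mul_conjTranspose_mul_self hu x y (-Complex.I)
  have hgram : (((√2)⁻¹ : ℝ) • B)ᴴ * (((√2)⁻¹ : ℝ) • B) +
      (((√2)⁻¹ : ℝ) • C)ᴴ * (((√2)⁻¹ : ℝ) • C) = τ := by
    simp only [Matrix.conjTranspose_smul, star_trivial, Matrix.smul_mul, Matrix.mul_smul,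
      smul_smul, ← smul_add, ← mul_inv, Real.mul_self_sqrt zero_le_two]
    rw [h.conjTranspose_mul_add_I_smul hxy hnorm, h.conjTranspose_mul_sub_I_smul hxy hnorm,
      add_add_sub_cancel, ← two_smul ℝ, inv_smul_smul₀ two_ne_zero]
  refine ⟨![((√2)⁻¹ : ℝ) • B * N, X * (((√2)⁻¹ : ℝ) • C * N)], ![1, Y], ?_, ?_, ?_⟩
  · rw [Fin.sum_univ_two]
    exact h.conjTranspose_mul_self_add_le_one hu hX hgram
  · exact Fin.forall_fin_two.2 ⟨(IsStarProjection.one _).norm_le, hY⟩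
  · refine Fin.forall_fin_two.2 ⟨?_, ?_⟩
    · simp [hBN]
    · calc
        _ = ((√2)⁻¹ : ℝ) • (X * (C * N * A u) * Y) := by simp [Matrix.mul_assoc]
        _ = ((√2)⁻¹ : ℝ) • B := by rw [hCN, hXY]

theorem norm_sub_I_smul_le (h : HasConstantMarginals A σ τ) (hE : 3 ≤ Module.finrank ℝ E)
    (hxy : ⟪x, y⟫ = 0) : ‖A x - Complex.I • A y‖ ≤ ‖A x + Complex.I • A y‖ := by
  classical
  obtain ⟨X, Y, hX, hY, hconj⟩ := h.exists_conj hE hxy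
  rw [← hconj]
  grw [Matrix.l2_opNorm_mul, Matrix.l2_opNorm_mul, hX, hY, one_mul, mul_one]

theorem eq_zero_or_eq_zero_of_norm_sq_le (h : HasConstantMarginals A σ τ)
    (hE : 3 ≤ Module.finrank ℝ E) (hu : ‖u‖ = 1) (hτ : τ ≠ 0) (hxy : ⟪x, y⟫ = 0)
    (hnorm : ‖x‖ ^ 2 + ‖y‖ ^ 2 = 1) (hle : ‖A x + Complex.I • A y‖ ^ 2 ≤ ‖τ‖) :
    x = 0 ∨ y = 0 := by
  set D := (2 * Complex.I) • ((A x)ᴴ * A y)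
  have hplus : ‖τ + D‖ ≤ ‖τ‖ := by
    rwa [← h.conjTranspose_mul_add_I_smul hxy hnorm, Matrix.l2_opNorm_conjTranspose_mul_self, ← sq]
  have hminus : ‖τ - D‖ ≤ ‖τ‖ := by
    rw [← h.conjTranspose_mul_sub_I_smul hxy hnorm, Matrix.l2_opNorm_conjTranspose_mul_self, ← sq]
    exact (pow_le_pow_left₀ (norm_nonneg _) (h.norm_sub_I_smul_le hE hxy) 2).trans hle
  have hτsq : ‖τ * τ‖ = ‖τ‖ ^ 2 :=
    IsSelfAdjoint.norm_mul_self (h.isHermitian_right hu).isSelfAdjoint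
  have hbound : (2 + 8 * ‖x‖ ^ 2 * ‖y‖ ^ 2) * ‖τ‖ ^ 2 ≤ 2 * ‖τ‖ ^ 2 := by
    calc
      (2 + 8 * ‖x‖ ^ 2 * ‖y‖ ^ 2) * ‖τ‖ ^ 2 = ‖(2 + 8 * ‖x‖ ^ 2 * ‖y‖ ^ 2) • (τ * τ)‖ := by
        rw [norm_smul_of_nonneg (by positivity), hτsq]
      _ = ‖(τ + D) * (τ + D) + (τ - D) * (τ - D)‖ := by
        have hsq : (τ + D) * (τ + D) + (τ - D) * (τ - D) = (2 : ℝ) • (τ * τ + D * D) := by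
          rw [two_smul]
          noncomm_ring
        rw [hsq, h.two_I_smul_conjTranspose_mul_mul_self hxy]
        congr 1
        module
      _ ≤ ‖τ + D‖ * ‖τ + D‖ + ‖τ - D‖ * ‖τ - D‖ := by
        grw [norm_add_le, norm_mul_le, norm_mul_le]
      _ ≤ 2 * ‖τ‖ ^ 2 := by
        nlinarith [norm_nonneg (τ + D), norm_nonneg (τ - D)]
  have hpos : 0 < ‖τ‖ ^ 2 := by positivity
  have hprod : ‖x‖ ^ 2 * ‖y‖ ^ 2 = 0 := by
    refine le_antisymm ?_ (by positivity)
    nlinarith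
  simpa using hprod

end HasConstantMarginals

end ConstantMarginals

section States

variable {ι κ : Type} [Fintype ι]

theorem eq_of_le_of_trace_eq {X Y : Matrix ι ι ℂ} (hXY : X ≤ Y) (htrace : X.trace = Y.trace) :
    X = Y := by
  rw [eq_comm, ← sub_eq_zero, ← (Matrix.le_iff.1 hXY).trace_eq_zero_iff, Matrix.trace_sub, htrace,
    sub_self]

theorem posSemidef_proj {ι : Type} [Finite ι] (ψ : ι → ℂ) : (proj ψ).PosSemidef :=
  Matrix.posSemidef_vecMulVec_self_star ψ

theorem proj_smul {ι : Type} (c : ℂ) (ψ : ι → ℂ) : proj (c • ψ) = ‖c‖ ^ 2 • proj ψ := by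
  have hc : c * star c = (‖c‖ ^ 2 : ℝ) := by simpa using Complex.mul_conj' c
  rw [proj, star_smul, Matrix.smul_vecMulVec, Matrix.vecMulVec_smul, smul_smul, hc, proj,
    Complex.coe_smul]

theorem trace_proj (ψ : ι → ℂ) : (proj ψ).trace = star ψ ⬝ᵥ ψ := by
  rw [proj, Matrix.trace_vecMulVec, dotProduct_comm]

theorem proj_mulVec (N : Matrix κ ι ℂ) (ψ : ι → ℂ) : proj (N *ᵥ ψ) = N * proj ψ * Nᴴ := by
  rw [proj, proj, Matrix.mul_vecMulVec, Matrix.vecMulVec_mul, Matrix.star_mulVec]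

theorem proj_mem_pureStates {ψ : ι → ℂ} (hψ : star ψ ⬝ᵥ ψ = 1) : proj ψ ∈ pureStates ι :=
  ⟨⟨posSemidef_proj ψ, by rw [trace_proj, hψ]⟩, ψ, rfl⟩

theorem exists_nonneg_eq_smul_proj_of_le {X : Matrix ι ι ℂ} {Φ : ι → ℂ} {t : ℝ}
    (hX : X.PosSemidef) (hΦ : star Φ ⬝ᵥ Φ = 1) (hle : X ≤ t • proj Φ) :
    ∃ s : ℝ, 0 ≤ s ∧ X = s • proj Φ := by
  classical
  set Q := 1 - proj Φ with hQ
  have hproj : proj Φ * Q = 0 := by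
    rw [hQ, Matrix.mul_sub, Matrix.mul_one, proj, Matrix.vecMulVec_mul_vecMulVec, hΦ, one_smul,
      sub_self]
  have hcompress : Qᴴ * X * Q = 0 := by
    refine le_antisymm ?_ (hX.conjTranspose_mul_mul_same Q).nonneg
    calc
      Qᴴ * X * Q ≤ Qᴴ * (t • proj Φ) * Q := conjTranspose_mul_mul_le_conjTranspose_mul_mul hle Q
      _ = 0 := by rw [Matrix.mul_assoc, Matrix.smul_mul, hproj, smul_zero, Matrix.mul_zero]
  have hXQ : X * Q = 0 := by
    refine Matrix.ext_of_mulVec_single fun i => ?_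
    rw [← Matrix.mulVec_mulVec, Matrix.zero_mulVec, ← hX.dotProduct_mulVec_zero_iff,
      Matrix.star_mulVec, ← Matrix.dotProduct_mulVec, Matrix.mulVec_mulVec, Matrix.mulVec_mulVec,
      hcompress, Matrix.zero_mulVec, dotProduct_zero]
  have hright : X = X * proj Φ := by
    rwa [hQ, Matrix.mul_sub, Matrix.mul_one, sub_eq_zero] at hXQ
  have hleft : X = proj Φ * X := by
    simpa [hX.1.eq, (posSemidef_proj Φ).1.eq] using congrArg Matrix.conjTranspose hright
  refine ⟨(star Φ ⬝ᵥ X *ᵥ Φ).re, (Complex.nonneg_iff.1 (hX.dotProduct_mulVec_nonneg Φ)).1, ?_⟩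
  calc
    X = proj Φ * (X * proj Φ) := by rw [← hright, ← hleft]
    _ = (star Φ ⬝ᵥ X *ᵥ Φ) • proj Φ := by
      rw [proj, Matrix.mul_vecMulVec, Matrix.vecMulVec_mul_vecMulVec, Matrix.vecMulVec_smul]
    _ = (star Φ ⬝ᵥ X *ᵥ Φ).re • proj Φ := by
      rw [← Complex.coe_smul, ← Complex.eq_re_of_ofReal_le (r := 0)
        (by simpa using hX.dotProduct_mulVec_nonneg Φ)]

end States

section Norms

variable {ι m n : Type*} [Fintype ι] [Fintype m] [Fintype n] [DecidableEq m] {κ : ι → Type*}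
  [∀ i, Fintype (κ i)]

theorem norm_sq_le_sum_norm_mul_sq [DecidableEq n] {K : ∀ i, Matrix (κ i) m ℂ}
    (hK : ∑ i, (K i)ᴴ * K i = 1) (T : Matrix m n ℂ) : ‖T‖ ^ 2 ≤ ∑ i, ‖K i * T‖ ^ 2 := by
  have hgram : Tᴴ * T = ∑ i, (K i * T)ᴴ * (K i * T) := by
    simp only [Matrix.conjTranspose_mul, Matrix.mul_assoc, ← Matrix.mul_sum]
    simp only [← Matrix.mul_assoc, ← Matrix.sum_mul, hK, Matrix.one_mul]
  simp only [sq, ← Matrix.l2_opNorm_conjTranspose_mul_self]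
  rw [hgram]
  exact norm_sum_le _ _

theorem norm_sq_le_sum_norm_mul_transpose_sq [∀ i, DecidableEq (κ i)]
    {K : ∀ i, Matrix (κ i) m ℂ} (hK : ∑ i, (K i)ᴴ * K i = 1) (T : Matrix n m ℂ) :
    ‖T‖ ^ 2 ≤ ∑ i, ‖T * (K i)ᵀ‖ ^ 2 := by
  classical
  have hK' : ∑ i, ((K i)ᵀᴴ)ᴴ * (K i)ᵀᴴ = 1 := by
    calc
      _ = (∑ i, (K i)ᴴ * K i)ᵀ := by
        simp only [Matrix.transpose_sum, Matrix.transpose_mul, Matrix.conjTranspose_conjTranspose]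
        rfl
      _ = 1 := by rw [hK, Matrix.transpose_one]
  simpa only [← Matrix.conjTranspose_mul, Matrix.l2_opNorm_conjTranspose] using
    norm_sq_le_sum_norm_mul_sq hK' Tᴴ

theorem transpose_conjTranspose_mul_transpose_le_one [DecidableEq n] {Y : Matrix m n ℂ}
    (hY : ‖Y‖ ≤ 1) : Yᵀᴴ * Yᵀ ≤ 1 := by
  have hle : Yᴴᴴ * Yᴴ ≤ 1 :=
    conjTranspose_mul_self_le_one (by rwa [Matrix.l2_opNorm_conjTranspose])
  have htranspose : (1 - Yᴴᴴ * Yᴴ)ᵀ = 1 - Yᵀᴴ * Yᵀ := by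
    rw [Matrix.transpose_sub, Matrix.transpose_one, Matrix.transpose_mul,
      Matrix.conjTranspose_conjTranspose]
    rfl
  rw [Matrix.le_iff] at hle ⊢
  exact htranspose ▸ hle.transpose

end Norms

section Protocols

variable {a b a' b' k : ℕ}

theorem sum_kronecker_one_conjTranspose_mul {c : Fin k → ℕ}
    {K : ∀ i, Matrix (Fin (c i)) (Fin a) ℂ} (hK : ∑ i, (K i)ᴴ * K i = 1) :
    ∑ i, (K i ⊗ₖ (1 : Matrix (Fin b) (Fin b) ℂ))ᴴ *
      (K i ⊗ₖ (1 : Matrix (Fin b) (Fin b) ℂ)) = 1 := by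
  simp only [Matrix.conjTranspose_kronecker, ← Matrix.mul_kronecker_mul, Matrix.conjTranspose_one,
    Matrix.one_mul]
  rw [← Matrix.one_kronecker_one, ← hK]
  ext i j
  simp only [Matrix.sum_apply, Matrix.kroneckerMap_apply, Finset.sum_mul]

theorem sum_one_kronecker_conjTranspose_mul {c : Fin k → ℕ}
    {K : ∀ i, Matrix (Fin (c i)) (Fin b) ℂ} (hK : ∑ i, (K i)ᴴ * K i = 1) :
    ∑ i, ((1 : Matrix (Fin a) (Fin a) ℂ) ⊗ₖ K i)ᴴ *
      ((1 : Matrix (Fin a) (Fin a) ℂ) ⊗ₖ K i) = 1 := by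
  simp only [Matrix.conjTranspose_kronecker, ← Matrix.mul_kronecker_mul, Matrix.conjTranspose_one,
    Matrix.one_mul]
  rw [← Matrix.one_kronecker_one, ← hK]
  ext i j
  simp only [Matrix.sum_apply, Matrix.kroneckerMap_apply, Finset.mul_sum]

theorem sum_trace_mul_mul_conjTranspose {ι n : Type*} {κ : ι → Type*} [Fintype ι] [Fintype n]
    [∀ i, Fintype (κ i)] [DecidableEq n] {N : ∀ i, Matrix (κ i) n ℂ}
    (hN : ∑ i, (N i)ᴴ * N i = 1) (X : Matrix n n ℂ) :
    ∑ i, (N i * X * (N i)ᴴ).trace = X.trace := by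
  simp_rw [fun i => Matrix.trace_mul_comm (N i * X) (N i)ᴴ, ← Matrix.mul_assoc]
  rw [← Matrix.trace_sum, ← Matrix.sum_mul, hN, Matrix.one_mul]

namespace LOCCProtocol

theorem posSemidef_channel (p : LOCCProtocol a' b' a b)
    {X : Matrix (Fin a × Fin b) (Fin a × Fin b) ℂ} (hX : X.PosSemidef) :
    (p.channel X).PosSemidef := by
  induction p with
  | done => exact hX
  | alice c K _ next ih =>
    exact Matrix.posSemidef_sum _ fun i _ => ih i (hX.mul_mul_conjTranspose_same _)
  | bob c K _ next ih =>
    exact Matrix.posSemidef_sum _ fun i _ => ih i (hX.mul_mul_conjTranspose_same _)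

theorem trace_channel (p : LOCCProtocol a' b' a b)
    (X : Matrix (Fin a × Fin b) (Fin a × Fin b) ℂ) : (p.channel X).trace = X.trace := by
  induction p with
  | done => rfl
  | alice c K hK next ih =>
    simp only [channel, Matrix.trace_sum, ih]
    exact sum_trace_mul_mul_conjTranspose (sum_kronecker_one_conjTranspose_mul hK) X
  | bob c K hK next ih =>
    simp only [channel, Matrix.trace_sum, ih]
    exact sum_trace_mul_mul_conjTranspose (sum_one_kronecker_conjTranspose_mul hK) X

theorem channel_smul (p : LOCCProtocol a' b' a b) (r : ℝ)
    (X : Matrix (Fin a × Fin b) (Fin a × Fin b) ℂ) : p.channel (r • X) = r • p.channel X := by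
  induction p with
  | done => rfl
  | alice c K hK next ih =>
    simp only [channel, Matrix.mul_smul, Matrix.smul_mul, ih, Finset.smul_sum]
  | bob c K hK next ih =>
    simp only [channel, Matrix.mul_smul, Matrix.smul_mul, ih, Finset.smul_sum]

end LOCCProtocol

theorem convex_setOf_loccConvertible (X : Matrix (Fin a × Fin b) (Fin a × Fin b) ℂ) :
    Convex ℝ {Y : Matrix (Fin a' × Fin b') (Fin a' × Fin b') ℂ | LOCCConvertible X Y} := by
  rintro _ ⟨p, rfl⟩ _ ⟨q, rfl⟩ s t hs ht hst
  have hsqrt : ∀ {r : ℝ}, 0 ≤ r →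
      ((√r • (1 : Matrix (Fin a) (Fin a) ℂ)) ⊗ₖ (1 : Matrix (Fin b) (Fin b) ℂ)) * X *
        ((√r • (1 : Matrix (Fin a) (Fin a) ℂ)) ⊗ₖ (1 : Matrix (Fin b) (Fin b) ℂ))ᴴ = r • X := by
    intro r hr
    rw [Matrix.smul_kronecker, Matrix.one_kronecker_one, Matrix.conjTranspose_smul, star_trivial,
      Matrix.conjTranspose_one, Matrix.smul_mul, Matrix.one_mul, Matrix.mul_smul, Matrix.mul_one,
      smul_smul, Real.mul_self_sqrt hr]
  refine ⟨.alice (fun _ : Fin 2 => a) ![√s • 1, √t • 1] ?_ ![p, q], ?_⟩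
  · simp [Fin.sum_univ_two, smul_smul, hs, ht, ← add_smul, hst]
  · simp [LOCCProtocol.channel, Fin.sum_univ_two, hsqrt hs, hsqrt ht, LOCCProtocol.channel_smul]

theorem conjTranspose_sqrt_mul_sqrt {P : Matrix (Fin a) (Fin a) ℂ} (hP : 0 ≤ P) :
    (CFC.sqrt P)ᴴ * CFC.sqrt P = P := by
  rw [(Matrix.nonneg_iff_posSemidef.1 (CFC.sqrt_nonneg P)).isHermitian.eq,
    CFC.sqrt_mul_sqrt_self P hP]

theorem exists_alice_protocol_le_channel {U : Matrix (Fin a) (Fin a) ℂ} (hU : Uᴴ * U ≤ 1) :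
    ∃ p : LOCCProtocol a b a b, ∀ X, X.PosSemidef →
      (U ⊗ₖ (1 : Matrix (Fin b) (Fin b) ℂ)) * X * (U ⊗ₖ 1)ᴴ ≤ p.channel X := by
  refine ⟨.alice (fun _ : Fin 2 => a) ![U, CFC.sqrt (1 - Uᴴ * U)] ?_ fun _ => .done, ?_⟩
  · simp [Fin.sum_univ_two, conjTranspose_sqrt_mul_sqrt (sub_nonneg.2 hU)]
  · intro X hX
    simpa [LOCCProtocol.channel, Fin.sum_univ_two] using
      (hX.mul_mul_conjTranspose_same (CFC.sqrt (1 - Uᴴ * U) ⊗ₖ 1)).nonneg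

theorem exists_bob_protocol_le_channel {K : Fin k → Matrix (Fin b) (Fin b) ℂ}
    (hK : ∑ i, (K i)ᴴ * K i ≤ 1) (p : Fin k → LOCCProtocol a b a b) :
    ∃ q : LOCCProtocol a b a b, ∀ X, X.PosSemidef →
      ∑ i, (p i).channel (((1 : Matrix (Fin a) (Fin a) ℂ) ⊗ₖ K i) * X * (1 ⊗ₖ K i)ᴴ) ≤
        q.channel X := by
  set R := CFC.sqrt (1 - ∑ i, (K i)ᴴ * K i) with hR
  refine ⟨.bob (fun _ : Fin (k + 1) => b) (Fin.cons R K) ?_ (Fin.cons .done p), ?_⟩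
  · simp [Fin.sum_univ_succ, hR, conjTranspose_sqrt_mul_sqrt (sub_nonneg.2 hK)]
  · intro X hX
    simpa [LOCCProtocol.channel, Fin.sum_univ_succ] using
      (hX.mul_mul_conjTranspose_same (1 ⊗ₖ R)).nonneg

-- Trace preservation forces the outcomes that complete the two measurements to have probability 0.
theorem loccConvertible_of_trace_eq {K : Fin k → Matrix (Fin b) (Fin b) ℂ}
    {U : Fin k → Matrix (Fin a) (Fin a) ℂ} (hK : ∑ i, (K i)ᴴ * K i ≤ 1)
    (hU : ∀ i, (U i)ᴴ * U i ≤ 1) {X : Matrix (Fin a × Fin b) (Fin a × Fin b) ℂ}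
    (hX : X.PosSemidef)
    (htrace : (∑ i, (U i ⊗ₖ K i) * X * (U i ⊗ₖ K i)ᴴ).trace = X.trace) :
    LOCCConvertible X (∑ i, (U i ⊗ₖ K i) * X * (U i ⊗ₖ K i)ᴴ) := by
  choose p hp using fun i => exists_alice_protocol_le_channel (b := b) (hU i)
  obtain ⟨q, hq⟩ := exists_bob_protocol_le_channel hK p
  refine ⟨q, (eq_of_le_of_trace_eq ?_ (htrace.trans (q.trace_channel X).symm)).symm⟩
  refine (Finset.sum_le_sum fun i _ => ?_).trans (hq X hX)
  have hUK : U i ⊗ₖ K i = (U i ⊗ₖ 1) * (1 ⊗ₖ K i) := by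
    rw [← Matrix.mul_kronecker_mul, Matrix.mul_one, Matrix.one_mul]
  calc
    (U i ⊗ₖ K i) * X * (U i ⊗ₖ K i)ᴴ =
        (U i ⊗ₖ 1) * ((1 ⊗ₖ K i) * X * (1 ⊗ₖ K i)ᴴ) * (U i ⊗ₖ 1)ᴴ := by
      rw [hUK, Matrix.conjTranspose_mul]
      simp only [Matrix.mul_assoc]
    _ ≤ (p i).channel ((1 ⊗ₖ K i) * X * (1 ⊗ₖ K i)ᴴ) := hp i _ (hX.mul_mul_conjTranspose_same _)

theorem loccConvertible_proj_vec {K : Fin k → Matrix (Fin b) (Fin b) ℂ}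
    {Y : Fin k → Matrix (Fin a) (Fin a) ℂ} (hK : ∑ i, (K i)ᴴ * K i ≤ 1) (hY : ∀ i, ‖Y i‖ ≤ 1)
    {S T : Matrix (Fin b) (Fin a) ℂ} {c : Fin k → ℝ} (hc : ∑ i, c i ^ 2 = 1)
    (hKY : ∀ i, K i * T * Y i = c i • S) (hST : star S.vec ⬝ᵥ S.vec = star T.vec ⬝ᵥ T.vec) :
    LOCCConvertible (proj T.vec) (proj S.vec) := by
  have hterm : ∀ i, ((Y i)ᵀ ⊗ₖ K i) * proj T.vec * ((Y i)ᵀ ⊗ₖ K i)ᴴ = c i ^ 2 • proj S.vec := by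
    intro i
    rw [← proj_mulVec, Matrix.kronecker_mulVec_vec, Matrix.transpose_transpose, hKY,
      ← Complex.coe_smul, Matrix.vec_smul, proj_smul, Complex.norm_real, Real.norm_eq_abs, sq_abs]
  have hsum : ∑ i, ((Y i)ᵀ ⊗ₖ K i) * proj T.vec * ((Y i)ᵀ ⊗ₖ K i)ᴴ = proj S.vec := by
    simp only [hterm, ← Finset.sum_smul, hc, one_smul]
  rw [← hsum]
  refine loccConvertible_of_trace_eq hK
    (fun i => transpose_conjTranspose_mul_transpose_le_one (hY i)) (posSemidef_proj _) ?_
  rw [hsum, trace_proj, trace_proj, hST]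

theorem exists_nonneg_of_sum_eq_smul_proj {ι : Type} [Fintype ι] {Y : Fin k → Matrix ι ι ℂ}
    {Φ : ι → ℂ} {t : ℝ} (hY : ∀ i, (Y i).PosSemidef) (hΦ : star Φ ⬝ᵥ Φ = 1)
    (hsum : ∑ i, Y i = t • proj Φ) :
    ∃ s : Fin k → ℝ, (∀ i, 0 ≤ s i) ∧ (∀ i, Y i = s i • proj Φ) ∧ ∑ i, s i = t := by
  choose s hs hsY using fun i => exists_nonneg_eq_smul_proj_of_le (hY i) hΦ
    ((Finset.single_le_sum (fun j _ => (hY j).nonneg) (Finset.mem_univ i)).trans_eq hsum)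
  refine ⟨s, hs, hsY, ?_⟩
  have htrace := congrArg Matrix.trace hsum
  simp only [hsY, ← Finset.sum_smul, Matrix.trace_smul, trace_proj, hΦ, Complex.real_smul,
    mul_one] at htrace
  exact_mod_cast htrace

theorem conjTranspose_mul_self_eq_traceB_transpose (T : Matrix (Fin b) (Fin a) ℂ) :
    Tᴴ * T = (traceB (proj T.vec))ᵀ := by
  ext i j
  simp [traceB, proj, Matrix.vecMulVec_apply, Matrix.mul_apply, mul_comm]

theorem traceB_smul (t : ℝ) (X : Matrix (Fin a × Fin b) (Fin a × Fin b) ℂ) :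
    traceB (t • X) = t • traceB X := by
  ext i j
  simp [traceB, Finset.mul_sum]

theorem LOCCProtocol.norm_sq_le {S : Matrix (Fin b') (Fin a') ℂ} (hS : star S.vec ⬝ᵥ S.vec = 1)
    (p : LOCCProtocol a' b' a b) {T : Matrix (Fin b) (Fin a) ℂ} {t : ℝ} (ht : 0 ≤ t)
    (h : p.channel (proj T.vec) = t • proj S.vec) : ‖T‖ ^ 2 ≤ t * ‖S‖ ^ 2 := by
  induction p generalizing t with
  | done =>
    rw [LOCCProtocol.channel] at h
    have hgram : Tᴴ * T = t • (Sᴴ * S) := by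
      simp only [conjTranspose_mul_self_eq_traceB_transpose, h, traceB_smul, Matrix.transpose_smul]
    rw [sq, sq, ← Matrix.l2_opNorm_conjTranspose_mul_self,
      ← Matrix.l2_opNorm_conjTranspose_mul_self, hgram, norm_smul_of_nonneg ht]
  | alice c K hK next ih =>
    simp only [LOCCProtocol.channel, ← proj_mulVec, Matrix.kronecker_mulVec_vec,
      Matrix.one_mul] at h
    obtain ⟨s, hs, hsY, rfl⟩ := exists_nonneg_of_sum_eq_smul_proj
      (fun i => (next i).posSemidef_channel (posSemidef_proj _)) hS h
    rw [Finset.sum_mul]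
    exact (norm_sq_le_sum_norm_mul_transpose_sq hK T).trans
      (Finset.sum_le_sum fun i _ => ih i (hs i) (hsY i))
  | bob c K hK next ih =>
    simp only [LOCCProtocol.channel, ← proj_mulVec, Matrix.kronecker_mulVec_vec,
      Matrix.transpose_one, Matrix.mul_one] at h
    obtain ⟨s, hs, hsY, rfl⟩ := exists_nonneg_of_sum_eq_smul_proj
      (fun i => (next i).posSemidef_channel (posSemidef_proj _)) hS h
    rw [Finset.sum_mul]
    exact (norm_sq_le_sum_norm_mul_sq hK T).trans
      (Finset.sum_le_sum fun i _ => ih i (hs i) (hsY i))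

end Protocols

section DensityMatrices

variable {ι κ : Type} [Fintype ι] [Fintype κ]

theorem proj_single_mem_realPureStates [DecidableEq ι] (i : ι) :
    proj (Pi.single i 1) ∈ realPureStates ι := by
  have hpure : proj (Pi.single i 1) ∈ pureStates ι := proj_mem_pureStates (by simp)
  refine ⟨hpure, hpure.1, fun j k => ?_⟩
  obtain rfl | hj := eq_or_ne j i <;> obtain rfl | hk := eq_or_ne k j <;>
    simp_all [proj, Matrix.vecMulVec_apply, Pi.single_apply]

theorem exists_pos_smul_proj_mem_pureStates {v : ι → ℂ} (hv : v ≠ 0) :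
    ∃ r : ℝ, 0 < r ∧ r • proj v ∈ pureStates ι := by
  obtain ⟨s, hs, hsv : (s : ℂ) = star v ⬝ᵥ v⟩ :=
    RCLike.pos_iff_exists_ofReal.1 (Matrix.dotProduct_star_self_pos_iff.2 hv)
  have hproj : s⁻¹ • proj v = proj (((√s)⁻¹ : ℝ) • v : ι → ℂ) := by
    rw [← Complex.coe_smul ((√s)⁻¹), proj_smul, Complex.norm_real, Real.norm_eq_abs, sq_abs,
      inv_pow, Real.sq_sqrt hs.le]
  refine ⟨s⁻¹, inv_pos.2 hs, ⟨(posSemidef_proj v).smul (inv_nonneg.2 hs.le), ?_⟩, _, hproj⟩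
  rw [Matrix.trace_smul, trace_proj, ← hsv, Complex.real_smul]
  exact_mod_cast inv_mul_cancel₀ hs.ne'

theorem mem_convexHull_pureStates {ρ : Matrix ι ι ℂ} (hρ : ρ ∈ states ι) :
    ρ ∈ convexHull ℝ (pureStates ι) := by
  classical
  have hH := hρ.1.isHermitian
  let v : ι → ι → ℂ := fun k => ⇑(hH.eigenvectorBasis k)
  have hspectral : ρ = ∑ k, hH.eigenvalues k • proj (v k) := by
    conv_lhs => rw [hH.spectral_theorem, Unitary.conjStarAlgAut_apply]
    ext i j
    rw [Matrix.mul_apply]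
    simp only [Matrix.mul_diagonal, Matrix.star_apply, Matrix.sum_apply,
      Matrix.smul_apply, proj, Matrix.vecMulVec_apply, hH.eigenvectorUnitary_apply,
      Pi.star_apply, Complex.real_smul, v]
    exact Finset.sum_congr rfl fun k _ => by
      rw [mul_right_comm, mul_comm]
      rfl
  have hv : ∀ k, star (v k) ⬝ᵥ v k = 1 := fun k => by
    rw [dotProduct_comm]
    exact (orthonormal_iff_ite.1 hH.eigenvectorBasis.orthonormal k k).trans (if_pos rfl)
  have hsum : ∑ k, hH.eigenvalues k = 1 := by
    have htrace : ∑ k, (hH.eigenvalues k : ℂ) = 1 := hH.trace_eq_sum_eigenvalues.symm.trans hρ.2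
    exact_mod_cast htrace
  rw [hspectral]
  exact (convex_convexHull ℝ _).sum_mem (fun k _ => hρ.1.eigenvalues_nonneg k) hsum
    fun k _ => subset_convexHull ℝ _ (proj_mem_pureStates (hv k))

theorem exists_mem_states_mem_openSegment {ρ σ : Matrix ι ι ℂ} (hρ : ρ ∈ states ι)
    (hσ : σ ∈ states ι) {p : ℝ} (hp : 0 < p) (hle : p • σ ≤ ρ) :
    ∃ σ' ∈ states ι, ρ ∈ openSegment ℝ σ σ' := by
  set q := min p 2⁻¹
  have hq : 0 < q := lt_min hp (by norm_num)
  have hq' : 0 < 1 - q := sub_pos.2 ((min_le_right _ _).trans_lt (by norm_num))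
  have hqle : q • σ ≤ ρ :=
    (smul_le_smul_of_nonneg_right (min_le_left _ _) hσ.1.nonneg).trans hle
  refine ⟨(1 - q)⁻¹ • (ρ - q • σ), ⟨(Matrix.le_iff.1 hqle).smul (inv_nonneg.2 hq'.le), ?_⟩,
    q, 1 - q, hq, hq', add_sub_cancel _ _, ?_⟩
  · rw [Matrix.trace_smul, Matrix.trace_sub, Matrix.trace_smul, hρ.2, hσ.2, Complex.real_smul,
      Complex.real_smul, mul_one]
    exact_mod_cast inv_mul_cancel₀ hq'.ne'
  · rw [smul_inv_smul₀ hq'.ne', add_sub_cancel]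

theorem exists_pos_smul_proj_mulVec_le {ρ : Matrix ι ι ℂ} (hρ : ρ.PosSemidef) (φ : ι → ℂ) :
    ∃ p : ℝ, 0 < p ∧ p • proj (ρ *ᵥ φ) ≤ ρ := by
  classical
  set R := CFC.sqrt ρ
  have hR : Rᴴ = R := (Matrix.nonneg_iff_posSemidef.1 (CFC.sqrt_nonneg ρ)).isHermitian.eq
  have hRR : R * R = ρ := CFC.sqrt_mul_sqrt_self ρ hρ.nonneg
  set s := ‖proj (R *ᵥ φ)‖ + 1
  have hs : 0 < s := by positivity
  have hle : proj (R *ᵥ φ) ≤ algebraMap ℝ _ s :=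
    (posSemidef_proj (R *ᵥ φ)).isHermitian.isSelfAdjoint.le_algebraMap_norm_self.trans
      (algebraMap_mono _ (le_add_of_nonneg_right zero_le_one))
  refine ⟨s⁻¹, inv_pos.2 hs, (inv_smul_le_iff_of_pos hs).2 ?_⟩
  calc
    proj (ρ *ᵥ φ) = R * proj (R *ᵥ φ) * Rᴴ := by
      rw [← proj_mulVec, Matrix.mulVec_mulVec, hRR]
    _ ≤ R * algebraMap ℝ _ s * Rᴴ := by
      have := conjTranspose_mul_mul_le_conjTranspose_mul_mul hle Rᴴ
      rwa [Matrix.conjTranspose_conjTranspose] at this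
    _ = s • ρ := by
      rw [Algebra.algebraMap_eq_smul_one, Matrix.mul_smul, Matrix.smul_mul, Matrix.mul_one, hR, hRR]

theorem apply_mul_star_apply_comm {ι : Type} {v w : ι → ℂ}
    (h : ∀ (c : ℂ) (i j : ι), (proj (v + c • w) i j).im = 0) (i j : ι) :
    v i * star (w j) = v j * star (w i) := by
  have h₁ := h 1 i j
  have h₂ := h (-1) i j
  have h₃ := h Complex.I i j
  have h₄ := h (-Complex.I) i j
  simp only [proj, Matrix.vecMulVec_apply, Pi.star_apply, Pi.add_apply, Pi.smul_apply, smul_eq_mul,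
    Complex.star_def, map_add, map_mul, map_neg, map_one, Complex.conj_I, Complex.mul_im,
    Complex.add_re, Complex.add_im, Complex.mul_re, Complex.conj_re, Complex.conj_im,
    Complex.neg_re, Complex.neg_im, Complex.one_re, Complex.one_im, Complex.I_re,
    Complex.I_im] at h₁ h₂ h₃ h₄
  apply Complex.ext
  · simp only [Complex.mul_re, Complex.star_def, Complex.conj_re, Complex.conj_im]
    linarith
  · simp only [Complex.mul_im, Complex.star_def, Complex.conj_re, Complex.conj_im]
    linarith

theorem apply_mul_apply_comm {ρ : Matrix ι ι ℂ} (hρ : ρ.IsHermitian)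
    (h : ∀ (φ : ι → ℂ) (i j : ι), (proj (ρ *ᵥ φ) i j).im = 0) (i j k l : ι) :
    ρ i k * ρ l j = ρ j k * ρ l i := by
  classical
  have hcol := apply_mul_star_apply_comm (v := ρ *ᵥ Pi.single k 1) (w := ρ *ᵥ Pi.single l 1)
    (fun c => by simpa only [Matrix.mulVec_add, Matrix.mulVec_smul] using h (_ + c • _)) i j
  simpa only [Matrix.mulVec_single_one, Matrix.col_apply, hρ.apply] using hcol

theorem mem_realPureStates_of_forall_proj_mulVec {ρ : Matrix ι ι ℂ} (hρ : ρ ∈ states ι)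
    (h : ∀ (φ : ι → ℂ) (i j : ι), (proj (ρ *ᵥ φ) i j).im = 0) : ρ ∈ realPureStates ι := by
  have hminor := apply_mul_apply_comm hρ.1.isHermitian h
  have hgram : ρ = ρᵀ * ρ := by
    ext i k
    calc
      ρ i k = ρ i k * ρ.trace := by rw [hρ.2, mul_one]
      _ = ∑ j, ρ i k * ρ j j := Finset.mul_sum _ _ _
      _ = (ρᵀ * ρ) i k := by
        simp only [hminor i, Matrix.mul_apply, Matrix.transpose_apply, mul_comm]
  have hsymm : ∀ i j, ρ i j = ρ j i := fun i j => congrFun₂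
    (show ρ = ρᵀ by rw [hgram, Matrix.transpose_mul, Matrix.transpose_transpose]) i j
  have hreal : ∀ i j, star (ρ i j) = ρ i j :=
    fun i j => (hρ.1.isHermitian.apply j i).trans (hsymm j i)
  obtain ⟨i, hi⟩ : ∃ i, ρ i i ≠ 0 := by
    by_contra! hdiag
    exact zero_ne_one ((Finset.sum_eq_zero fun i _ => hdiag i).symm.trans hρ.2)
  have hrow : proj (ρ i) = (ρ i i).re • ρ := by
    ext l j
    rw [proj, Matrix.vecMulVec_apply, Pi.star_apply, hreal, Matrix.smul_apply, Complex.real_smul,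
      Complex.conj_eq_iff_re.1 (hreal i i), hminor, hsymm j l, mul_comm]
  obtain ⟨r, -, hr⟩ := exists_pos_smul_proj_mem_pureStates fun h0 => hi (congrFun h0 i)
  rw [hrow, smul_smul] at hr
  have htrace := hr.1.2
  rw [Matrix.trace_smul, hρ.2, Complex.real_smul, mul_one, Complex.ofReal_eq_one] at htrace
  rw [htrace, one_smul] at hr
  exact ⟨hr, hρ, fun i j => Complex.conj_eq_iff_im.1 (hreal i j)⟩

theorem mem_realPureStates_of_forall_smul_le {ρ : Matrix ι ι ℂ} (hρ : ρ ∈ states ι)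
    (h : ∀ σ ∈ pureStates ι, ∀ p : ℝ, 0 < p → p • σ ≤ ρ → σ ∈ realPureStates ι) :
    ρ ∈ realPureStates ι := by
  refine mem_realPureStates_of_forall_proj_mulVec hρ fun φ i j => ?_
  obtain hφ | hφ := eq_or_ne (ρ *ᵥ φ) 0
  · simp [hφ, proj, Matrix.vecMulVec_apply]
  obtain ⟨r, hr, hpure⟩ := exists_pos_smul_proj_mem_pureStates hφ
  obtain ⟨p, hp, hle⟩ := exists_pos_smul_proj_mulVec_le hρ.1 φ
  have hreal := (h _ hpure (p * r⁻¹) (by positivity)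
    (by rwa [mul_smul, inv_smul_smul₀ hr.ne'])).2.2 i j
  simpa [hr.ne'] using hreal

theorem mul_mul_conjTranspose_mem_states [DecidableEq ι] {M : Matrix κ ι ℂ} (hM : Mᴴ * M = 1)
    {ρ : Matrix ι ι ℂ} (hρ : ρ ∈ states ι) : M * ρ * Mᴴ ∈ states κ :=
  ⟨hρ.1.mul_mul_conjTranspose_same M, by
    rw [Matrix.trace_mul_comm, ← Matrix.mul_assoc, hM, Matrix.one_mul, hρ.2]⟩

theorem mul_mul_conjTranspose_mem_pureStates [DecidableEq ι] {M : Matrix κ ι ℂ} (hM : Mᴴ * M = 1)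
    {ρ : Matrix ι ι ℂ} (hρ : ρ ∈ pureStates ι) : M * ρ * Mᴴ ∈ pureStates κ := by
  obtain ⟨hρ, ψ, rfl⟩ := hρ
  exact ⟨mul_mul_conjTranspose_mem_states hM hρ, M *ᵥ ψ, (proj_mulVec M ψ).symm⟩

end DensityMatrices

section RealVectors

variable {ι : Type}

/-- The inclusion of real vectors into `ℂ^ι`. -/
def complexify : EuclideanSpace ℝ ι →ₗ[ℝ] ι → ℂ where
  toFun x i := x i
  map_add' x y := by
    ext i
    simp
  map_smul' r x := by
    ext i
    simp

theorem star_complexify (x : EuclideanSpace ℝ ι) : star (complexify x) = complexify x := by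
  ext i
  exact Complex.conj_ofReal (x i)

theorem exists_eq_complexify_add_I_smul (ψ : ι → ℂ) :
    ∃ x y : EuclideanSpace ℝ ι, ψ = complexify x + Complex.I • complexify y := by
  refine ⟨.toLp 2 fun i => (ψ i).re, .toLp 2 fun i => (ψ i).im, funext fun i => ?_⟩
  simp only [complexify, LinearMap.coe_mk, AddHom.coe_mk, Pi.add_apply, Pi.smul_apply, smul_eq_mul,
    mul_comm Complex.I, Complex.re_add_im]

theorem proj_complexify_add_I_smul_im (x y : EuclideanSpace ℝ ι) (i j : ι) :
    (proj (complexify x + Complex.I • complexify y) i j).im = y i * x j - x i * y j := by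
  change ((x i + Complex.I * y i) * (starRingEnd ℂ) (x j + Complex.I * y j)).im = _
  simp only [map_add, map_mul, Complex.conj_I, Complex.conj_ofReal, Complex.mul_im, Complex.mul_re,
    Complex.add_im, Complex.add_re, Complex.neg_im, Complex.neg_re, Complex.I_im, Complex.I_re,
    Complex.ofReal_im, Complex.ofReal_re]
  ring

variable [Fintype ι]

theorem complexify_dotProduct (x y : EuclideanSpace ℝ ι) :
    complexify x ⬝ᵥ complexify y = (⟪x, y⟫ : ℝ) := by
  simp [complexify, dotProduct, PiLp.inner_apply, mul_comm]

theorem star_dotProduct_complexify_add_I_smul (x y : EuclideanSpace ℝ ι) :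
    star (complexify x + Complex.I • complexify y) ⬝ᵥ (complexify x + Complex.I • complexify y) =
      (‖x‖ ^ 2 + ‖y‖ ^ 2 : ℝ) := by
  simp only [star_add, star_smul, star_complexify, add_dotProduct, dotProduct_add, smul_dotProduct,
    dotProduct_smul, complexify_dotProduct, real_inner_self_eq_norm_sq, real_inner_comm x y,
    Complex.star_def, Complex.conj_I, smul_eq_mul]
  push_cast
  linear_combination (-(‖y‖ : ℂ) ^ 2) * Complex.I_sq

theorem dotProduct_self_complexify_add_I_smul_im (x y : EuclideanSpace ℝ ι) :
    ((complexify x + Complex.I • complexify y) ⬝ᵥ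
      (complexify x + Complex.I • complexify y)).im = 2 * ⟪x, y⟫ := by
  simp only [add_dotProduct, dotProduct_add, smul_dotProduct, dotProduct_smul,
    complexify_dotProduct, real_inner_comm x y, smul_eq_mul, Complex.add_im, Complex.I_mul_im,
    Complex.add_re, Complex.I_mul_re, Complex.ofReal_re, Complex.ofReal_im]
  ring

theorem exists_norm_eq_one_sq_mul_im_eq_zero (z : ℂ) : ∃ c : ℂ, ‖c‖ = 1 ∧ (c ^ 2 * z).im = 0 := by
  refine ⟨Complex.exp ((-(z.arg / 2) : ℝ) * Complex.I), Complex.norm_exp_ofReal_mul_I _, ?_⟩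
  have hphase : Complex.exp ((-(z.arg / 2) : ℝ) * Complex.I) ^ 2 *
      Complex.exp (z.arg * Complex.I) = 1 := by
    rw [← Complex.exp_nat_mul, ← Complex.exp_add, ← Complex.exp_zero]
    push_cast
    ring_nf
  have hz : Complex.exp ((-(z.arg / 2) : ℝ) * Complex.I) ^ 2 * z = ‖z‖ := by
    nth_rw 2 [← Complex.norm_mul_exp_arg_mul_I z]
    rw [mul_left_comm, hphase, mul_one]
  rw [hz, Complex.ofReal_im]

theorem exists_orthogonal_of_mem_pureStates {ρ : Matrix ι ι ℂ} (hρ : ρ ∈ pureStates ι) :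
    ∃ x y : EuclideanSpace ℝ ι, ⟪x, y⟫ = 0 ∧ ‖x‖ ^ 2 + ‖y‖ ^ 2 = 1 ∧
      ρ = proj (complexify x + Complex.I • complexify y) := by
  obtain ⟨⟨-, htrace⟩, ψ, rfl⟩ := hρ
  obtain ⟨c, hc, him⟩ := exists_norm_eq_one_sq_mul_im_eq_zero (ψ ⬝ᵥ ψ)
  obtain ⟨x, y, hxy⟩ := exists_eq_complexify_add_I_smul (c • ψ)
  have hproj : proj ψ = proj (complexify x + Complex.I • complexify y) := by
    rw [← hxy, proj_smul, hc, one_pow, one_smul]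
  refine ⟨x, y, ?_, ?_, hproj⟩
  · have hinner := dotProduct_self_complexify_add_I_smul_im x y
    rw [← hxy, smul_dotProduct, dotProduct_smul, smul_smul, smul_eq_mul, ← sq, him] at hinner
    linarith
  · rw [hproj, trace_proj, star_dotProduct_complexify_add_I_smul] at htrace
    exact_mod_cast htrace

theorem proj_im_eq_zero_iff {x y : EuclideanSpace ℝ ι} (hxy : ⟪x, y⟫ = 0) :
    (∀ i j, (proj (complexify x + Complex.I • complexify y) i j).im = 0) ↔ x = 0 ∨ y = 0 := by
  simp only [proj_complexify_add_I_smul_im]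
  constructor
  · intro h
    have hnorm : ‖x‖ ^ 2 * ‖y‖ ^ 2 = ⟪x, y⟫ * ⟪x, y⟫ := by
      simp only [EuclideanSpace.real_norm_sq_eq, PiLp.inner_apply, Finset.sum_mul_sum]
      refine Finset.sum_congr rfl fun i _ => Finset.sum_congr rfl fun j _ => ?_
      simp only [RCLike.inner_apply, conj_trivial]
      linear_combination (-(x i * y j)) * h i j
    simpa [hxy] using hnorm
  · rintro (rfl | rfl) i j <;> simp

theorem exists_proj_complexify_of_mem_realPureStates {ρ : Matrix ι ι ℂ}
    (hρ : ρ ∈ realPureStates ι) :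
    ∃ u : EuclideanSpace ℝ ι, ‖u‖ = 1 ∧ ρ = proj (complexify u) := by
  obtain ⟨hpure, -, hreal⟩ := hρ
  obtain ⟨x, y, hxy, hnorm, rfl⟩ := exists_orthogonal_of_mem_pureStates hpure
  obtain rfl | rfl := (proj_im_eq_zero_iff hxy).1 hreal
  · refine ⟨y, by simpa [pow_eq_one_iff_of_nonneg] using hnorm, ?_⟩
    rw [map_zero, zero_add, proj_smul, Complex.norm_I, one_pow, one_smul]
  · exact ⟨x, by simpa [pow_eq_one_iff_of_nonneg] using hnorm, by simp⟩

theorem proj_complexify_mem_realStates {u : EuclideanSpace ℝ ι} (hu : ‖u‖ = 1) :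
    proj (complexify u) ∈ realStates ι := by
  refine ⟨(proj_mem_pureStates ?_).1, fun i j => ?_⟩
  · rw [star_complexify, complexify_dotProduct, real_inner_self_eq_norm_sq, hu]
    simp
  · simpa using proj_complexify_add_I_smul_im u 0 i j

end RealVectors

section Maskers

variable {d a b : ℕ} {M : Matrix (Fin a × Fin b) (Fin d) ℂ}

/-- The coefficient matrices of the images `M |x⟩` of real vectors `x`. The vectorization of a
matrix enumerates its columns, so that Bob's index is the row index. -/
def coeffMatrix (M : Matrix (Fin a × Fin b) (Fin d) ℂ) :
    EuclideanSpace ℝ (Fin d) →ₗ[ℝ] Matrix (Fin b) (Fin a) ℂ where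
  toFun x := .of fun k i => (M *ᵥ complexify x) (i, k)
  map_add' x y := by
    ext k i
    simp [Matrix.mulVec_add]
  map_smul' r x := by
    ext k i
    simp [Matrix.mulVec_smul]

theorem vec_coeffMatrix (M : Matrix (Fin a × Fin b) (Fin d) ℂ) (x : EuclideanSpace ℝ (Fin d)) :
    (coeffMatrix M x).vec = M *ᵥ complexify x :=
  rfl

theorem vec_coeffMatrix_add_I_smul (M : Matrix (Fin a × Fin b) (Fin d) ℂ)
    (x y : EuclideanSpace ℝ (Fin d)) :
    (coeffMatrix M x + Complex.I • coeffMatrix M y).vec =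
      M *ᵥ (complexify x + Complex.I • complexify y) := by
  rw [Matrix.mulVec_add, Matrix.mulVec_smul, ← vec_coeffMatrix, ← vec_coeffMatrix, Matrix.vec_add,
    Matrix.vec_smul]

theorem mul_conjTranspose_self_eq_traceA (T : Matrix (Fin b) (Fin a) ℂ) :
    T * Tᴴ = traceA (proj T.vec) := by
  ext i j
  simp [traceA, proj, Matrix.vecMulVec_apply, Matrix.mul_apply]

theorem star_dotProduct_mulVec_self (hM : Mᴴ * M = 1) (ψ : Fin d → ℂ) :
    star (M *ᵥ ψ) ⬝ᵥ M *ᵥ ψ = star ψ ⬝ᵥ ψ := by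
  rw [Matrix.star_mulVec, ← Matrix.dotProduct_mulVec, Matrix.mulVec_mulVec, hM, Matrix.one_mulVec]

theorem star_dotProduct_vec_coeffMatrix (hM : Mᴴ * M = 1) {u : EuclideanSpace ℝ (Fin d)}
    (hu : ‖u‖ = 1) : star (coeffMatrix M u).vec ⬝ᵥ (coeffMatrix M u).vec = 1 := by
  rw [vec_coeffMatrix, star_dotProduct_mulVec_self hM, star_complexify, complexify_dotProduct,
    real_inner_self_eq_norm_sq, hu]
  simp

namespace IsMasker

theorem exists_hasConstantMarginals (hM : IsMasker M (realStates (Fin d))) :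
    ∃ σ τ, HasConstantMarginals (coeffMatrix M) σ τ := by
  obtain ⟨-, τA, -, τB, -, hmask⟩ := hM
  have hunit : ∀ {u : EuclideanSpace ℝ (Fin d)}, ‖u‖ = 1 →
      coeffMatrix M u * (coeffMatrix M u)ᴴ = τB ∧ (coeffMatrix M u)ᴴ * coeffMatrix M u = τAᵀ := by
    intro u hu
    obtain ⟨hA, hB⟩ := hmask _ (proj_complexify_mem_realStates hu)
    rw [← proj_mulVec, ← vec_coeffMatrix] at hA hB
    rw [mul_conjTranspose_self_eq_traceA, conjTranspose_mul_self_eq_traceB_transpose, hA, hB]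
    exact ⟨rfl, rfl⟩
  have hdecomp : ∀ x : EuclideanSpace ℝ (Fin d), x ≠ 0 → ∃ u, ‖u‖ = 1 ∧ x = ‖x‖ • u :=
    fun x hx => ⟨‖x‖⁻¹ • x, norm_smul_inv_norm hx, (smul_inv_smul₀ (norm_ne_zero_iff.2 hx) x).symm⟩
  refine ⟨τB, τAᵀ, fun x => ?_, fun x => ?_⟩
  all_goals
    obtain rfl | hx := eq_or_ne x 0
    · simp
    obtain ⟨u, hu, hxu⟩ := hdecomp x hx
    have hmap : coeffMatrix M x = ‖x‖ • coeffMatrix M u := by rw [← map_smul, ← hxu]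
    rw [hmap]
    simp only [Matrix.conjTranspose_smul, star_trivial, Matrix.smul_mul, Matrix.mul_smul,
      smul_smul, hunit hu, sq]

theorem loccConvertible (hd : 3 ≤ d) (hM : IsMasker M (realStates (Fin d)))
    {ρ₀ ρ : Matrix (Fin d) (Fin d) ℂ} (hρ₀ : ρ₀ ∈ realPureStates (Fin d))
    (hρ : ρ ∈ states (Fin d)) : LOCCConvertible (M * ρ₀ * Mᴴ) (M * ρ * Mᴴ) := by
  obtain ⟨σ, τ, h⟩ := hM.exists_hasConstantMarginals
  obtain ⟨u, hu, rfl⟩ := exists_proj_complexify_of_mem_realPureStates hρ₀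
  have hpure : ∀ ρ ∈ pureStates (Fin d),
      LOCCConvertible (M * proj (complexify u) * Mᴴ) (M * ρ * Mᴴ) := by
    intro ρ hρ
    obtain ⟨x, y, hxy, hnorm, rfl⟩ := exists_orthogonal_of_mem_pureStates hρ
    obtain ⟨K, Y, hK, hY, hKY⟩ := h.exists_measurement (by simpa using hd) hu hxy hnorm
    rw [← proj_mulVec, ← proj_mulVec, ← vec_coeffMatrix, ← vec_coeffMatrix_add_I_smul]
    refine loccConvertible_proj_vec hK hY (c := fun _ => (√2)⁻¹) (by simp) hKY ?_
    rw [star_dotProduct_vec_coeffMatrix hM.1 hu, vec_coeffMatrix_add_I_smul,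
      star_dotProduct_mulVec_self hM.1, star_dotProduct_complexify_add_I_smul, hnorm]
    simp
  have hconvex : Convex ℝ {ρ : Matrix (Fin d) (Fin d) ℂ |
      LOCCConvertible (M * proj (complexify u) * Mᴴ) (M * ρ * Mᴴ)} := by
    intro ρ hρ ρ' hρ' s t hs ht hst
    have hmix := convex_setOf_loccConvertible (M * proj (complexify u) * Mᴴ) hρ hρ' hs ht hst
    simpa only [Set.mem_ofPred_eq, Matrix.mul_add, Matrix.add_mul, Matrix.mul_smul,
      Matrix.smul_mul] using hmix
  exact convexHull_min hpure hconvex (mem_convexHull_pureStates hρ)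

theorem mem_realPureStates_of_loccConvertible (hd : 3 ≤ d) (hM : IsMasker M (realStates (Fin d)))
    {ρ₀ ρ : Matrix (Fin d) (Fin d) ℂ} (hρ₀ : ρ₀ ∈ realPureStates (Fin d))
    (hρ : ρ ∈ pureStates (Fin d)) (hconv : LOCCConvertible (M * ρ * Mᴴ) (M * ρ₀ * Mᴴ)) :
    ρ ∈ realPureStates (Fin d) := by
  obtain ⟨σ, τ, h⟩ := hM.exists_hasConstantMarginals
  obtain ⟨u, hu, rfl⟩ := exists_proj_complexify_of_mem_realPureStates hρ₀
  refine ⟨hρ, hρ.1, ?_⟩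
  obtain ⟨x, y, hxy, hnorm, rfl⟩ := exists_orthogonal_of_mem_pureStates hρ
  obtain ⟨p, hp⟩ := hconv
  have hτ : ‖coeffMatrix M u‖ ^ 2 = ‖τ‖ := by
    rw [sq, ← Matrix.l2_opNorm_conjTranspose_mul_self, h.conjTranspose_mul_of_norm_eq_one hu]
  have hS := star_dotProduct_vec_coeffMatrix hM.1 hu
  have hτ₀ : τ ≠ 0 := by
    rintro rfl
    rw [norm_zero, sq_eq_zero_iff, norm_eq_zero] at hτ
    simp [hτ] at hS
  have hle : ‖coeffMatrix M x + Complex.I • coeffMatrix M y‖ ^ 2 ≤ ‖τ‖ := by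
    rw [← hτ, ← one_mul (‖coeffMatrix M u‖ ^ 2)]
    refine p.norm_sq_le hS zero_le_one ?_
    rw [vec_coeffMatrix_add_I_smul, vec_coeffMatrix, proj_mulVec, proj_mulVec, hp, one_smul]
  exact (proj_im_eq_zero_iff hxy).2
    (h.eq_zero_or_eq_zero_of_norm_sq_le (by simpa using hd) hu hτ₀ hxy hnorm hle)

variable {E : Matrix (Fin a × Fin b) (Fin a × Fin b) ℂ → ℝ}

theorem apply_le (hd : 3 ≤ d) (hM : IsMasker M (realStates (Fin d)))
    (hE : IsEntanglementMonotone E) {ρ₀ ρ : Matrix (Fin d) (Fin d) ℂ}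
    (hρ₀ : ρ₀ ∈ realPureStates (Fin d)) (hρ : ρ ∈ states (Fin d)) :
    E (M * ρ * Mᴴ) ≤ E (M * ρ₀ * Mᴴ) :=
  hE _ (mul_mul_conjTranspose_mem_states hM.1 hρ₀.2.1) _
    (mul_mul_conjTranspose_mem_states hM.1 hρ) (hM.loccConvertible hd hρ₀ hρ)

theorem le_apply_of_smul_le (hd : 3 ≤ d) (hM : IsMasker M (realStates (Fin d)))
    (hE : IsEntanglementMonotone E) (hconv : ConvexOn ℝ (states (Fin a × Fin b)) E)
    {ρ₀ ρ σ : Matrix (Fin d) (Fin d) ℂ} (hρ₀ : ρ₀ ∈ realPureStates (Fin d))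
    (hρ : ρ ∈ states (Fin d)) (hσ : σ ∈ states (Fin d)) {p : ℝ} (hp : 0 < p) (hle : p • σ ≤ ρ)
    (heq : E (M * ρ * Mᴴ) = E (M * ρ₀ * Mᴴ)) : E (M * ρ₀ * Mᴴ) ≤ E (M * σ * Mᴴ) := by
  obtain ⟨σ', hσ', s, t, hs, ht, hst, rfl⟩ := exists_mem_states_mem_openSegment hρ hσ hp hle
  rw [← heq]
  refine hconv.le_left_of_right_le (mul_mul_conjTranspose_mem_states hM.1 hσ)
    (mul_mul_conjTranspose_mem_states hM.1 hσ') ⟨s, t, hs, ht, hst, ?_⟩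
    (heq ▸ hM.apply_le hd hE hρ₀ hσ')
  simp only [Matrix.mul_add, Matrix.add_mul, Matrix.mul_smul, Matrix.smul_mul]

theorem apply_eq_iff (hd : 3 ≤ d) (hM : IsMasker M (realStates (Fin d)))
    (hE : IsStrictEntanglementMonotone E) (hconv : ConvexOn ℝ (states (Fin a × Fin b)) E)
    {ρ₀ ρ : Matrix (Fin d) (Fin d) ℂ} (hρ₀ : ρ₀ ∈ realPureStates (Fin d))
    (hρ : ρ ∈ states (Fin d)) :
    E (M * ρ * Mᴴ) = E (M * ρ₀ * Mᴴ) ↔ ρ ∈ realPureStates (Fin d) := by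
  refine ⟨fun heq => ?_, fun hreal =>
    (hM.apply_le hd hE.1 hρ₀ hρ).antisymm (hM.apply_le hd hE.1 hreal hρ₀.2.1)⟩
  refine mem_realPureStates_of_forall_smul_le hρ fun σ hσ p hp hle => ?_
  refine hM.mem_realPureStates_of_loccConvertible hd hρ₀ hσ ?_
  by_contra hirrev
  exact (hE.2 _ (mul_mul_conjTranspose_mem_pureStates hM.1 hρ₀.1) _
    (mul_mul_conjTranspose_mem_pureStates hM.1 hσ) (hM.loccConvertible hd hρ₀ hσ.1)
    hirrev).not_ge (hM.le_apply_of_smul_le hd hE.1 hconv hρ₀ hρ hσ.1 hp hle heq)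

end IsMasker

end Maskers

end Masking

end

theorem theorem5 {d a b : ℕ} (hd : 3 ≤ d) (M : Matrix (Fin a × Fin b) (Fin d) ℂ)
    (hM : Masking.IsMasker M (Masking.realStates (Fin d)))
    (Ψ₀ : Fin a × Fin b → ℂ)
    (hΨ₀ : Ψ₀ = M *ᵥ Pi.single (⟨0, by omega⟩ : Fin d) 1) :
    (∀ ρ ∈ Masking.states (Fin d),
      Masking.LOCCConvertible (Masking.proj Ψ₀) (M * ρ * Mᴴ)) ∧
    (∀ E : Matrix (Fin a × Fin b) (Fin a × Fin b) ℂ → ℝ, Masking.IsEntanglementMonotone E →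
      ∀ ρ ∈ Masking.states (Fin d), E (M * ρ * Mᴴ) ≤ E (Masking.proj Ψ₀)) ∧
    (∀ E : Matrix (Fin a × Fin b) (Fin a × Fin b) ℂ → ℝ,
      Masking.IsStrictEntanglementMonotone E →
      ConvexOn ℝ (Masking.states (Fin a × Fin b)) E →
      ∀ ρ ∈ Masking.states (Fin d),
        (E (M * ρ * Mᴴ) = E (Masking.proj Ψ₀) ↔ ρ ∈ Masking.realPureStates (Fin d))) := by
  rw [hΨ₀, Masking.proj_mulVec]
  have hreal := Masking.proj_single_mem_realPureStates (⟨0, by omega⟩ : Fin d)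
  exact ⟨fun ρ hρ => hM.loccConvertible hd hreal hρ,
    fun E hE ρ hρ => hM.apply_le hd hE hreal hρ,
    fun E hE hconv ρ hρ => hM.apply_eq_iff hd hE hconv hreal hρ⟩
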